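/- Fix a natural number $d\ge 3$. Consider a two-sorted structure consisting of a set $B$ (bodies), a set $Q$ (quantities) with operations $+,\cdot$ and a relation $\le$, subsets $\mathrm{Ob},\mathrm{IOb},\mathrm{Ph}\subseteq B$ (observers, inertial observers, light signals), and a worldview relation $W\subseteq B\times B\times Q^d$, where $W(m,b,\bar x)$ is read "$m$ coordinatizes the body $b$ at $\bar x$". For $\bar x,\bar y\in Q^d$ put $$\mathsf{time}(\bar x,\bar y)=x_1-y_1,\qquad \mathsf{space}^2(\bar x,\bar y)=(x_2-y_2)^2+\dots+(x_d-y_d)^2,$$ and for $m,k,b\in B$ put $\mathsf{ev}_m(\bar x)=\{b: W(m,b,\bar x)\}$ and $\mathsf{wl}_m(b)=\{\bar x: W(m,b,\bar x)\}$. The worldview transformation $\mathsf{w}_{mk}$ is the binary relation on $Q^d$ given by $$\mathsf{w}_{mk}(\bar x,\bar y)\iff \mathsf{ev}_m(\bar x)=\mathsf{ev}_k(\bar y)\neq\emptyset .$$ A quantity $v$ is called a squared speed of $k$ according to $m$ if there are $\bar x\ne\bar y$ in $\mathsf{wl}_m(k)$ with $\mathsf{space}^2(\bar x,\bar y)=v\cdot\mathsf{time}(\bar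 x,\bar y)^2$. Assume the axiom system $\mathsf{SpecRel}$, that is: - (AxOField) $\langle Q,+,\cdot,\le\rangle$ is a (linearly) ordered field. - (AxPh) For every $m\in\mathrm{IOb}$ there is $c_m>0$ in $Q$ such that, for all $\bar x,\bar y\in Q^d$, there is $p\in\mathrm{Ph}$ with $W(m,p,\bar x)$ and $W(m,p,\bar y)$ if and only if $\mathsf{space}^2(\bar x,\bar y)=c_m^2\cdot\mathsf{time}(\bar x,\bar y)^2$. - (AxEv) For all $m,k\in\mathrm{IOb}$ and $\bar x\in Q^d$ there is $\bar y\in Q^d$ with $\mathsf{ev}_m(\bar x)=\mathsf{ev}_k(\bar y)$. - (AxSelf) For all $m\in\mathrm{IOb}$ and $\bar x\in Q^d$: $W(m,m,\bar x)$ if and only if $x_2=\dots=x_d=0$. - (AxSymD) For all $m,k\in\mathrm{IOb}$ and $\bar x,\bar y,\bar x',\bar y'\in Q^d$ with $x_1=y_1$, $x_1'=y_1'$, $\mathsf{ev}_m(\bar x)=\mathsf{ev}_k(\bar x')$ and $\mathsf{ev}_m(\bar y)=\mathsf{ev}_k(\bar y')$, we have $\mathsf{space}^2(\bar x,\bar y)=\mathsf{space}^2(\bar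 x',\bar y')$. Moreover, for every $m\in\mathrm{IOb}$ there is $p\in\mathrm{Ph}$ with $W(m,p,\langle 0,\dots,0\rangle)$ and $W(m,p,\langle 1,1,0,\dots,0\rangle)$. Let $m,k\in\mathrm{IOb}$. Then there is exactly one squared speed of $k$ according to $m$, denoted by $\mathsf{speed}^2_m(k)$, and $\mathsf{speed}^2_m(k)\neq 1$. Furthermore, if $\bar x,\bar y\in\mathsf{wl}_k(k)$ and $\bar x',\bar y'\in Q^d$ satisfy $\mathsf{w}_{km}(\bar x,\bar x')$ and $\mathsf{w}_{km}(\bar y,\bar y')$, then $$\mathsf{time}(\bar x',\bar y')^2=\frac{\mathsf{time}(\bar x,\bar y)^2}{1-\mathsf{speed}^2_m(k)} .$$ -/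

import Mathlib

/-- A structure for the two-sorted language `{B, Q; Ob, IOb, Ph, +, ·, ≤, W}` of `d`-dimensional
spacetime: `B` is the sort of bodies and `Q` the sort of quantities (whose operations and order
are supplied by type classes); `Ob`, `IOb`, `Ph` single out the observers, the inertial observers
and the light signals; `W m b x` says that `m` coordinatizes the body `b` at the coordinate point
`x`. A coordinate point is a `d`-tuple of quantities; its coordinate number `0` is the time
coordinate and all the other ones are spatial. -/
structure WorldviewModel (B Q : Type*) (d : ℕ) where
  Ob : B → Prop
  IOb : B → Prop
  Ph : B → Prop
  W : B → B → (Fin d → Q) → Prop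

/-- Time difference of two coordinate points. -/
def timeDiff {Q : Type*} [Field Q] {d : ℕ} [NeZero d] (x y : Fin d → Q) : Q :=
  x 0 - y 0

/-- Squared spatial distance of two coordinate points. -/
def spaceSq {Q : Type*} [Field Q] {d : ℕ} [NeZero d] (x y : Fin d → Q) : Q :=
  ∑ i ∈ Finset.univ.filter (fun i : Fin d => i ≠ 0), (x i - y i) ^ 2

namespace WorldviewModel

/-- The event occurring for `m` at `x`: the set of bodies which `m` coordinatizes at `x`. -/
def ev {B Q : Type*} {d : ℕ} (M : WorldviewModel B Q d) (m : B) (x : Fin d → Q) : Set B :=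
  {b | M.W m b x}

/-- The worldline of the body `b` according to `m`. -/
def wl {B Q : Type*} {d : ℕ} (M : WorldviewModel B Q d) (m b : B) : Set (Fin d → Q) :=
  {x | M.W m b x}

/-- The worldview transformation between `m` and `k`, as a binary relation. -/
def worldview {B Q : Type*} {d : ℕ} (M : WorldviewModel B Q d) (m k : B)
    (x y : Fin d → Q) : Prop :=
  M.ev m x = M.ev k y ∧ (M.ev m x).Nonempty

/-- `M.SpeedSq m k v`: the quantity `v` is a squared speed of `k` according to `m`. -/
def SpeedSq {B Q : Type*} [Field Q] {d : ℕ} [NeZero d] (M : WorldviewModel B Q d)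
    (m k : B) (v : Q) : Prop :=
  ∃ x y : Fin d → Q, x ≠ y ∧ M.W m k x ∧ M.W m k y ∧ spaceSq x y = v * timeDiff x y ^ 2

/-- For any inertial observer the speed of light is a positive quantity, the same everywhere and
in every direction, and light signals can be sent out everywhere in every direction. -/
def AxPh {B Q : Type*} [Field Q] [LinearOrder Q] {d : ℕ} [NeZero d]
    (M : WorldviewModel B Q d) : Prop :=
  ∀ m, M.IOb m → ∃ c : Q, 0 < c ∧ ∀ x y : Fin d → Q,
    (∃ p, M.Ph p ∧ M.W m p x ∧ M.W m p y) ↔ spaceSq x y = c ^ 2 * timeDiff x y ^ 2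

/-- All inertial observers coordinatize the same set of events. -/
def AxEv {B Q : Type*} {d : ℕ} (M : WorldviewModel B Q d) : Prop :=
  ∀ m k, M.IOb m → M.IOb k → ∀ x : Fin d → Q, ∃ y : Fin d → Q,
    ∀ b, M.W m b x ↔ M.W k b y

/-- Any inertial observer is stationary, at the spatial origin, relative to himself. -/
def AxSelf {B Q : Type*} [Field Q] {d : ℕ} [NeZero d] (M : WorldviewModel B Q d) : Prop :=
  ∀ m, M.IOb m → ∀ x : Fin d → Q, M.W m m x ↔ ∀ i, i ≠ 0 → x i = 0

/-- Any two inertial observers agree as to the spatial distance between two events which are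
simultaneous for both of them; and every inertial observer coordinatizes a light signal at the
origin and at the point `⟨1, 1, 0, …, 0⟩`. -/
def AxSymD {B Q : Type*} [Field Q] {d : ℕ} [NeZero d] (M : WorldviewModel B Q d) : Prop :=
  (∀ m k, M.IOb m → M.IOb k → ∀ x y x' y' : Fin d → Q,
    x 0 = y 0 → x' 0 = y' 0 → M.ev m x = M.ev k x' → M.ev m y = M.ev k y' →
      spaceSq x y = spaceSq x' y') ∧
  (∀ m, M.IOb m → ∃ p, M.Ph p ∧ M.W m p (fun _ => 0) ∧
    M.W m p (fun i => if i.val ≤ 1 then 1 else 0))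

/-- The axiom system of special relativity. The remaining axiom, that the quantities form an
ordered field, is expressed by the type classes. -/
structure SpecRel {B Q : Type*} [Field Q] [LinearOrder Q] [IsStrictOrderedRing Q]
    {d : ℕ} [NeZero d] (M : WorldviewModel B Q d) : Prop where
  axPh : M.AxPh
  axEv : M.AxEv
  axSelf : M.AxSelf
  axSymD : M.AxSymD

end WorldviewModel

/-!
By the axioms on light signals and events, the worldview transformation of two inertial observers
is a permutation of the coordinate points that preserves lightlike separation. As in the
Alexandrov–Zeeman theorem, such a permutation is a translation composed with a semilinear
similarity of the Minkowski form: images of light lines are light lines, parallelograms with null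
sides go to parallelograms, whence additivity, and comparing the scale factors along different
null directions shows that they are given by one field endomorphism. A nonzero vector which is
purely spatial for both observers exists because `d ≥ 3`; by `AxSymD` its multiples keep their
lengths, so the similarity is a Lorentz transformation. It maps the worldline of `k` to a line
with direction `T` of square `-1`, and `γ = T 0` satisfies `(1 - v) γ² = 1`.
-/

/-- Every element is a difference of two squares. -/
theorem map_mul_of_map_mul_sq {K : Type*} [Field K] [NeZero (2 : K)] {σ : K →+ K}
    (h : ∀ b t, σ (b * t ^ 2) = σ b * σ (t ^ 2)) (b c : K) : σ (b * c) = σ b * σ c := by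
  have hc : c = ((c + 1) / 2) ^ 2 - ((c - 1) / 2) ^ 2 := by field_simp; ring
  rw [hc, mul_sub, map_sub, map_sub, h, h, mul_sub]

theorem eq_one_and_eq_id_of_mul_map_sq_mul {K : Type*} [Field K] [NeZero (2 : K)] {σ : K →+* K}
    {a c : K} (hc : c ≠ 0) (h : ∀ t, a * σ (t ^ 2 * c) = t ^ 2 * c) : a = 1 ∧ σ = RingHom.id K := by
  have map_sq : ∀ t, σ t ^ 2 = t ^ 2 := fun t => mul_right_cancel₀ hc <| by
    have h1 : a * σ c = c := by simpa using h 1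
    have ht := h t
    rw [map_mul, map_pow] at ht
    linear_combination ht - σ t ^ 2 * h1
  have map_eq : ∀ t, σ t = t := fun t => by
    have := map_sq (t + 1)
    rw [map_add, map_one] at this
    exact mul_left_cancel₀ two_ne_zero (by linear_combination this - map_sq t)
  refine ⟨mul_right_cancel₀ hc ?_, RingHom.ext map_eq⟩
  simpa [map_eq] using h 1

section BilinForm

variable {K V : Type*} [Field K] [AddCommGroup V] [Module K V] {B : LinearMap.BilinForm K V}

/-- Null (isotropic, lightlike) vectors of a bilinear form. -/
def IsNull (B : LinearMap.BilinForm K V) (v : V) : Prop := B v v = 0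

/-- Nondegenerate symmetric bilinear forms of Witt index one, i.e. possessing nonzero null vectors
but no totally null planes. The Minkowski form is the motivating example. -/
structure IsWittIndexOne (B : LinearMap.BilinForm K V) : Prop where
  isSymm : B.IsSymm
  nondegenerate : B.Nondegenerate
  exists_isNull : ∃ u ≠ 0, IsNull B u
  exists_eq_smul : ∀ ⦃u v : V⦄, u ≠ 0 → IsNull B u → IsNull B v → B u v = 0 → ∃ c : K, v = c • u

theorem IsNull.smul {u : V} (hu : IsNull B u) (c : K) : IsNull B (c • u) := by
  rw [IsNull] at hu ⊢
  simp only [map_smul, LinearMap.smul_apply, hu, smul_zero]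

theorem IsNull.sub_comm {u v : V} (h : IsNull B (u - v)) : IsNull B (v - u) := by
  simpa only [neg_smul, one_smul, neg_sub] using h.smul (-1)

theorem exists_ne_zero_orthogonal (hV : 2 < Module.rank K V) (p q : V) :
    ∃ z ≠ 0, B z p = 0 ∧ B z q = 0 := by
  let φ : V →ₗ[K] K × K := (B.flip p).prod (B.flip q)
  have hφ : ¬ Function.Injective φ := fun h => by
    have := LinearMap.lift_rank_le_of_injective φ h
    rw [rank_prod', Module.rank_self, one_add_one_eq_two, Cardinal.lift_ofNat,
      Cardinal.lift_le_ofNat_iff] at this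
    exact hV.not_ge this
  rw [← LinearMap.ker_eq_bot, ← Ne, Submodule.ne_bot_iff] at hφ
  obtain ⟨z, hz, hz0⟩ := hφ
  exact ⟨z, hz0, Prod.ext_iff.1 hz⟩

theorem smul_mem_closure_isNull {w n : V} (hn : IsNull B n) (hnw : B n w ≠ 0) (a : K) :
    a • n ∈ AddSubgroup.closure {u | IsNull B u ∧ B u w ≠ 0} := by
  obtain rfl | ha := eq_or_ne a 0
  · rw [zero_smul]
    exact zero_mem _
  · refine AddSubgroup.subset_closure ⟨hn.smul a, ?_⟩
    simpa only [map_smul, LinearMap.smul_apply, smul_eq_mul] using mul_ne_zero ha hnw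

theorem IsWittIndexOne.not_isNull_of_orthogonal (hB : IsWittIndexOne B) {u w z : V}
    (hu : IsNull B u) (huw : B u w ≠ 0) (hz0 : z ≠ 0) (hzu : B z u = 0) (hzw : B z w = 0) :
    ¬ IsNull B z := by
  intro hz
  obtain ⟨c, rfl⟩ := hB.exists_eq_smul (by rintro rfl; simp at huw) hu hz (hB.isSymm.eq z u ▸ hzu)
  have hc : c = 0 := by simpa [huw] using hzw
  exact hz0 (by rw [hc, zero_smul])

variable [NeZero (2 : K)]

theorem isNull_add_iff (hB : B.IsSymm) {u v : V} (hu : IsNull B u) (hv : IsNull B v) :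
    IsNull B (u + v) ↔ B u v = 0 := by
  rw [IsNull] at hu hv
  simp only [IsNull, map_add, LinearMap.add_apply, hu, hv, hB.eq v u, zero_add, add_zero,
    ← two_mul, mul_eq_zero, two_ne_zero, false_or]

theorem isNull_sub_iff (hB : B.IsSymm) {u v : V} (hu : IsNull B u) (hv : IsNull B v) :
    IsNull B (u - v) ↔ B u v = 0 := by
  rw [sub_eq_add_neg, isNull_add_iff hB hu (by simpa using hv.smul (-1)), map_neg, neg_eq_zero]

/-- `B x x / (2 * B x w)` is the parameter at which the line `x - t • w` meets the light cone. -/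
theorem isNull_sub_smul (hB : B.IsSymm) {w x : V} (hw : IsNull B w) (hxw : B x w ≠ 0) :
    IsNull B (x - (B x x / (2 * B x w)) • w) := by
  rw [IsNull] at hw ⊢
  simp only [map_sub, map_smul, LinearMap.sub_apply, LinearMap.smul_apply, smul_eq_mul, hw,
    hB.eq w x]
  field_simp [two_ne_zero (α := K)]
  ring

namespace IsWittIndexOne

theorem exists_isNull_apply_ne_zero (hB : IsWittIndexOne B) {w : V} (hw0 : w ≠ 0)
    (hw : IsNull B w) : ∃ u, IsNull B u ∧ B u w ≠ 0 := by
  obtain ⟨y, hy⟩ : ∃ y, B y w ≠ 0 := by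
    by_contra! h
    exact hw0 (hB.nondegenerate.2 w h)
  refine ⟨_, isNull_sub_smul hB.isSymm hw hy, ?_⟩
  rw [IsNull] at hw
  simpa [hw] using hy

theorem exists_hyperbolic_pair (hB : IsWittIndexOne B) (hV : 2 < Module.rank K V) {w : V}
    (hw0 : w ≠ 0) (hw : IsNull B w) :
    ∃ u z, IsNull B u ∧ B u w ≠ 0 ∧ B z u = 0 ∧ B z w = 0 ∧ B z z ≠ 0 := by
  obtain ⟨u, hu, huw⟩ := hB.exists_isNull_apply_ne_zero hw0 hw
  obtain ⟨z, hz0, hzu, hzw⟩ := exists_ne_zero_orthogonal (B := B) hV u w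
  exact ⟨u, z, hu, huw, hzu, hzw, hB.not_isNull_of_orthogonal hu huw hz0 hzu hzw⟩

theorem eq_of_forall_isNull_sub (hB : IsWittIndexOne B) {x y : V}
    (h : ∀ z, IsNull B (x - z) ↔ IsNull B (y - z)) : x = y := by
  by_contra hne
  have hxy : IsNull B (x - y) := (h y).2 (by simp [IsNull])
  obtain ⟨u, hu, huxy⟩ := hB.exists_isNull_apply_ne_zero (sub_ne_zero.2 hne) hxy
  -- `u + x` lies on the light cone of `x`, but not on that of `y`.
  have hyx : IsNull B (u + (x - y)) := by
    have := (h (u + x)).1 (by simpa using hu.smul (-1))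
    simpa [add_sub_assoc] using this.sub_comm
  exact huxy ((isNull_add_iff hB.isSymm hu hxy).1 hyx)

theorem closure_isNull_apply_ne_zero (hB : IsWittIndexOne B) (hV : 2 < Module.rank K V) {w : V}
    (hw0 : w ≠ 0) (hw : IsNull B w) :
    AddSubgroup.closure {u | IsNull B u ∧ B u w ≠ 0} = ⊤ := by
  set S := AddSubgroup.closure {u | IsNull B u ∧ B u w ≠ 0}
  have hww : B w w = 0 := hw
  have sub_smul_mem : ∀ x, B x w ≠ 0 → ∀ a : K, a • (x - (B x x / (2 * B x w)) • w) ∈ S :=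
    fun x hx => smul_mem_closure_isNull (isNull_sub_smul hB.isSymm hw hx) (by simpa [hww] using hx)
  obtain ⟨u, z, hu, huw, hzu, hzw, hzz⟩ := hB.exists_hyperbolic_pair hV hw0 hw
  have smul_mem : ∀ a : K, a • w ∈ S := by
    intro a
    have huu : B u u = 0 := hu
    have huz : B u z = 0 := hB.isSymm.eq z u ▸ hzu
    set c := B z z / (2 * B u w) with hc
    set b := a * B u w / B z z with hb
    have hadd : b • (u + z - c • w) ∈ S := by
      simpa [huu, huz, hzu, hzw] using sub_smul_mem (u + z) (by simpa [hzw] using huw) b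
    have hsub : b • (u - z - c • w) ∈ S := by
      simpa [huu, huz, hzu, hzw] using sub_smul_mem (u - z) (by simpa [hzw] using huw) b
    have hbc : a = 2 * (b * c) := by rw [hb, hc]; field_simp
    rw [show a • w = (2 * b) • u - (b • (u + z - c • w) + b • (u - z - c • w)) by
      rw [hbc]; module]
    exact S.sub_mem (smul_mem_closure_isNull hu huw (2 * b)) (S.add_mem hadd hsub)
  have mem_of_apply_ne_zero : ∀ x, B x w ≠ 0 → x ∈ S := fun x hx => by
    simpa using S.add_mem (sub_smul_mem x hx 1) (smul_mem (B x x / (2 * B x w)))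
  refine eq_top_iff.2 fun x _ => ?_
  by_cases hx : B x w = 0
  · have hxu := mem_of_apply_ne_zero (x + u) (by simpa [hx] using huw)
    simpa using S.sub_mem hxu (mem_of_apply_ne_zero u huw)
  · exact mem_of_apply_ne_zero x hx

theorem addMonoidHom_ext {A : Type*} [AddGroup A] (hB : IsWittIndexOne B)
    (hV : 2 < Module.rank K V) {w : V} (hw0 : w ≠ 0) (hw : IsNull B w) {φ ψ : V →+ A}
    (h : ∀ v, IsNull B v → B v w ≠ 0 → φ v = ψ v) : φ = ψ :=
  AddMonoidHom.eq_of_eqOn_dense (hB.closure_isNull_apply_ne_zero hV hw0 hw)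
    fun v hv => h v hv.1 hv.2

/-- The null vectors `t ^ 2 • u + w + t • z`, with `z` orthogonal to `u` and `w`, form a conic on
the light cone. -/
theorem exists_null_conic (hB : IsWittIndexOne B) (hV : 2 < Module.rank K V) :
    ∃ u w, IsNull B u ∧ IsNull B w ∧ B u w ≠ 0 ∧
      ∀ t : K, ∃ n, IsNull B n ∧ B n u = B w u ∧ B n w = t ^ 2 * B u w := by
  obtain ⟨w, hw0, hw⟩ := hB.exists_isNull
  obtain ⟨v, z, hv, hvw, hzv, hzw, hzz⟩ := hB.exists_hyperbolic_pair hV hw0 hw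
  set c := -(B z z / (2 * B v w))
  have hc : 2 * (c * B v w) = - B z z := by simp only [c]; field_simp
  have hvv : B v v = 0 := hv
  have hww : B w w = 0 := hw
  refine ⟨c • v, w, hv.smul c, hw, ?_, fun t => ⟨t ^ 2 • c • v + w + t • z, ?_, ?_, ?_⟩⟩
  · intro h
    rw [map_smul, LinearMap.smul_apply, smul_eq_mul] at h
    exact hzz (by rw [← neg_eq_zero, ← hc, h, mul_zero])
  · simp only [IsNull, map_add, map_smul, LinearMap.add_apply, LinearMap.smul_apply, smul_eq_mul,
      hvv, hww, hzv, hzw, hB.isSymm.eq v z, hB.isSymm.eq w z, hB.isSymm.eq w v]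
    linear_combination t ^ 2 * hc
  · simp [hvv, hzv]
  · simp [hww, hzw]

end IsWittIndexOne

end BilinForm

section Parallelogram

variable {V W : Type*} [AddCommGroup V] [AddCommGroup W]

/-- The vectors `x` such that `f` maps every parallelogram with sides `x` and `y` to a
parallelogram; `f` is affine over `ℤ` when this is everything for all `y`. -/
def parallelogramSubgroup (f : V → W) (y : V) : AddSubgroup V where
  carrier := {x | ∀ o, f (o + x + y) - f (o + x) = f (o + y) - f o}
  zero_mem' o := by rw [add_zero]
  add_mem' {x x'} hx hx' o := by rw [← add_assoc, hx', hx]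
  neg_mem' {x} hx o := by rw [← hx (o + -x), neg_add_cancel_right]

theorem mem_parallelogramSubgroup {f : V → W} {x y : V} :
    x ∈ parallelogramSubgroup f y ↔ ∀ o, f (o + x + y) - f (o + x) = f (o + y) - f o :=
  Iff.rfl

theorem mem_parallelogramSubgroup_comm {f : V → W} {x y : V}
    (h : x ∈ parallelogramSubgroup f y) : y ∈ parallelogramSubgroup f x := fun o => by
  rw [add_right_comm, sub_eq_sub_iff_add_eq_add, add_comm (f (o + x)),
    ← sub_eq_sub_iff_add_eq_add, h o]

end Parallelogram

section PreservesNull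

variable {K V : Type*} [Field K] [AddCommGroup V] [Module K V] {B : LinearMap.BilinForm K V}

/-- Permutations preserving lightlike separation in both directions. -/
def PreservesNull (B : LinearMap.BilinForm K V) (f : V ≃ V) : Prop :=
  ∀ x y, IsNull B (f x - f y) ↔ IsNull B (x - y)

namespace PreservesNull

variable {f : V ≃ V}

theorem symm (hf : PreservesNull B f) : PreservesNull B f.symm := fun x y => by
  rw [← hf, f.apply_symm_apply, f.apply_symm_apply]

theorem isNull_apply_add_sub_apply (hf : PreservesNull B f) {o u : V} :
    IsNull B (f (o + u) - f o) ↔ IsNull B u := by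
  rw [hf, add_sub_cancel_left]

variable [NeZero (2 : K)]

/-- Orthogonal null vectors are parallel. -/
theorem exists_apply_add_smul (hf : PreservesNull B f) (hB : IsWittIndexOne B) {u : V}
    (hu : IsNull B u) (o : V) (b : K) : ∃ c : K, f (o + b • u) - f o = c • (f (o + u) - f o) := by
  obtain rfl | hu0 := eq_or_ne u 0
  · exact ⟨0, by simp⟩
  have hU := (hf.isNull_apply_add_sub_apply (o := o)).2 hu
  have hX := (hf.isNull_apply_add_sub_apply (o := o)).2 (hu.smul b)
  have hUX : IsNull B (f (o + u) - f o - (f (o + b • u) - f o)) := by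
    rw [sub_sub_sub_cancel_right, hf, add_sub_add_left_eq_sub,
      show u - b • u = (1 - b) • u by module]
    exact hu.smul _
  refine hB.exists_eq_smul ?_ hU hX ((isNull_sub_iff hB.isSymm hU hX).1 hUX)
  simpa [sub_eq_zero] using hu0

theorem exists_apply_add_smul_eq (hf : PreservesNull B f) (hB : IsWittIndexOne B) {u : V}
    (hu : IsNull B u) (o : V) (c : K) : ∃ b : K, f (o + b • u) = f o + c • (f (o + u) - f o) := by
  obtain ⟨b, hb⟩ := hf.symm.exists_apply_add_smul hB
    ((hf.isNull_apply_add_sub_apply (o := o)).2 hu) (f o) c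
  rw [f.symm_apply_apply, add_sub_cancel, f.symm_apply_apply, add_sub_cancel_left,
    sub_eq_iff_eq_add', f.symm_apply_eq] at hb
  exact ⟨b, hb.symm⟩

/-- If `x - o` is not orthogonal to `u`, then a point of the line through `o` and `o + u` is
lightlike separated from `x`. If the images were orthogonal, `f x` would be lightlike separated
from every point of the image line. -/
theorem apply_sub_eq_zero_of_apply_map_sub_eq_zero (hf : PreservesNull B f)
    (hB : IsWittIndexOne B) {o u x : V} (hu : IsNull B u)
    (h : B (f x - f o) (f (o + u) - f o) = 0) : B (x - o) u = 0 := by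
  by_contra hxu
  have hU := (hf.isNull_apply_add_sub_apply (o := o)).2 hu
  obtain ⟨b, hb⟩ : ∃ b : K, IsNull B (x - (o + b • u)) :=
    ⟨_, by simpa only [sub_sub] using isNull_sub_smul hB.isSymm hu hxu⟩
  obtain ⟨c, hc⟩ := hf.exists_apply_add_smul hB hu o b
  have hX : IsNull B (f x - f o) := by
    have hXc := (hf _ _).2 hb
    rw [← sub_sub_sub_cancel_right _ _ (f o), hc] at hXc
    have := (isNull_add_iff hB.isSymm hXc (hU.smul c)).2 (by
      have hUU : B (f (o + u) - f o) (f (o + u) - f o) = 0 := hU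
      rw [map_smul, LinearMap.map_sub₂, LinearMap.map_smul₂, h, hUU]
      simp only [smul_zero, sub_zero])
    rwa [sub_add_cancel] at this
  have hXU : IsNull B (x - o - u) := by
    rw [sub_sub, ← hf, ← sub_sub_sub_cancel_right _ _ (f o)]
    exact (isNull_sub_iff hB.isSymm hX hU).2 h
  exact hxu ((isNull_sub_iff hB.isSymm ((hf _ _).1 hX) hu).1 hXU)

theorem apply_map_sub_eq_zero_iff (hf : PreservesNull B f) (hB : IsWittIndexOne B) {o u x : V}
    (hu : IsNull B u) : B (f x - f o) (f (o + u) - f o) = 0 ↔ B (x - o) u = 0 := by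
  refine ⟨hf.apply_sub_eq_zero_of_apply_map_sub_eq_zero hB hu, fun h => ?_⟩
  refine hf.symm.apply_sub_eq_zero_of_apply_map_sub_eq_zero hB
    (hf.isNull_apply_add_sub_apply.2 hu) ?_
  simpa using h

/-- If the images of the two parallel light lines were not parallel, some point of the first
image line would lie in the null hyperplane spanned by the second one, whereas no point of the
first line lies in the null hyperplane spanned by the second. -/
theorem exists_apply_add_sub_eq_smul (hf : PreservesNull B f) (hB : IsWittIndexOne B) {u w : V}
    (hu : IsNull B u) (huw : B u w ≠ 0) (o : V) :
    ∃ c : K, f (o + w + u) - f (o + w) = c • (f (o + u) - f o) := by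
  have hU := (hf.isNull_apply_add_sub_apply (o := o)).2 hu
  have hU' := (hf.isNull_apply_add_sub_apply (o := o + w)).2 hu
  have hu0 : u ≠ 0 := by rintro rfl; simp at huw
  refine hB.exists_eq_smul (by simpa [sub_eq_zero] using hu0) hU hU' ?_
  by_contra hUU'
  set U := f (o + u) - f o with hU_def
  set U' := f (o + w + u) - f (o + w) with hU'_def
  obtain ⟨b, hb⟩ := hf.exists_apply_add_smul_eq hB hu o (B (f (o + w) - f o) U' / B U U')
  have hmeet : B (f (o + b • u) - f (o + w)) U' = 0 := by
    rw [hb, ← hU_def, show ∀ s : K, f o + s • U - f (o + w) = s • U - (f (o + w) - f o) by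
      intro s; abel, LinearMap.map_sub₂, LinearMap.map_smul₂, smul_eq_mul,
      div_mul_cancel₀ _ hUU', sub_self]
  have huu : B u u = 0 := hu
  rw [hU'_def, hf.apply_map_sub_eq_zero_iff hB hu, add_sub_add_left_eq_sub] at hmeet
  simp [huu, hB.isSymm.eq w u, huw] at hmeet

theorem mem_parallelogramSubgroup_of_isNull (hf : PreservesNull B f) (hB : IsWittIndexOne B)
    {u w : V} (hu : IsNull B u) (hw : IsNull B w) (huw : B u w ≠ 0) :
    u ∈ parallelogramSubgroup f w := by
  intro o
  have hwu : B w u ≠ 0 := by rwa [hB.isSymm.eq]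
  obtain ⟨c, hc⟩ := hf.exists_apply_add_sub_eq_smul hB hu huw o
  obtain ⟨e, he⟩ := hf.exists_apply_add_sub_eq_smul hB hw hwu o
  have hUU : B (f (o + u) - f o) (f (o + u) - f o) = 0 := hf.isNull_apply_add_sub_apply.2 hu
  have hWU : B (f (o + w) - f o) (f (o + u) - f o) ≠ 0 := by
    rwa [Ne, hf.apply_map_sub_eq_zero_iff hB hu, add_sub_cancel_left]
  have hsides : (1 - e) • (f (o + w) - f o) = (1 - c) • (f (o + u) - f o) := by
    rw [sub_smul, sub_smul, ← hc, ← he, add_right_comm]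
    module
  have he1 : 1 - e = 0 := by
    have := congrArg (B · (f (o + u) - f o)) hsides
    simpa only [LinearMap.map_smul₂, hUU, smul_zero, smul_eq_mul, mul_zero, mul_eq_zero, hWU,
      or_false] using this
  rw [he, ← sub_eq_zero.1 he1, one_smul]

theorem mem_parallelogramSubgroup (hf : PreservesNull B f) (hB : IsWittIndexOne B)
    (hV : 2 < Module.rank K V) (x y : V) : x ∈ parallelogramSubgroup f y := by
  have mem_of_isNull : ∀ w ≠ 0, IsNull B w → ∀ x, x ∈ parallelogramSubgroup f w := by
    intro w hw0 hw x
    have hle := (AddSubgroup.closure_le _).2 fun u (hu : IsNull B u ∧ B u w ≠ 0) =>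
      hf.mem_parallelogramSubgroup_of_isNull hB hu.1 hw hu.2
    exact hle (hB.closure_isNull_apply_ne_zero hV hw0 hw ▸ AddSubgroup.mem_top x)
  obtain ⟨v, hv0, hv⟩ := hB.exists_isNull
  have hle := (AddSubgroup.closure_le (parallelogramSubgroup f x)).2
    fun w (hw : IsNull B w ∧ B w v ≠ 0) => mem_parallelogramSubgroup_comm
      (mem_of_isNull w (fun h => hw.2 (by simp [h])) hw.1 x)
  exact mem_parallelogramSubgroup_comm
    (hle (hB.closure_isNull_apply_ne_zero hV hv0 hv ▸ AddSubgroup.mem_top y))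

theorem exists_addEquiv (hf : PreservesNull B f) (hB : IsWittIndexOne B)
    (hV : 2 < Module.rank K V) : ∃ g : V ≃+ V, ∀ x y, f x - f y = g (x - y) := by
  have hsub : ∀ x y, f x - f y = f (x - y) - f 0 := fun x y => by
    simpa using hf.mem_parallelogramSubgroup hB hV y (x - y) 0
  refine ⟨AddEquiv.mk' (f.trans (Equiv.subRight (f 0))) fun x y => ?_, fun x y => ?_⟩
  · have := hsub (x + y) y
    rw [add_sub_cancel_right] at this
    simp [← this]
  · exact hsub x y

variable {g : V ≃+ V}

theorem apply_map_eq_zero_iff (hg : PreservesNull B g.toEquiv) (hB : IsWittIndexOne B) {x w : V}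
    (hw : IsNull B w) : B (g x) (g w) = 0 ↔ B x w = 0 := by
  simpa using hg.apply_map_sub_eq_zero_iff hB (o := 0) (x := x) hw

theorem apply_map_congr (hg : PreservesNull B g.toEquiv) (hB : IsWittIndexOne B) {x y w : V}
    (hw : IsNull B w) (h : B x w = B y w) : B (g x) (g w) = B (g y) (g w) := by
  rw [← sub_eq_zero, ← LinearMap.map_sub₂, ← map_sub, hg.apply_map_eq_zero_iff hB hw,
    LinearMap.map_sub₂, h, sub_self]

theorem exists_addMonoidHom_map_smul (hg : PreservesNull B g.toEquiv) (hB : IsWittIndexOne B)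
    {u : V} (hu0 : u ≠ 0) (hu : IsNull B u) :
    ∃ σ : K →+ K, σ 1 = 1 ∧ ∀ b : K, g (b • u) = σ b • g u := by
  have exists_smul : ∀ b : K, ∃ c : K, g (b • u) = c • g u := fun b => by
    simpa using hg.exists_apply_add_smul hB hu 0 b
  choose σ hσ using exists_smul
  have smul_inj := smul_left_injective K (g.map_ne_zero_iff.2 hu0)
  refine ⟨AddMonoidHom.mk' σ fun b c => smul_inj ?_, smul_inj ?_, hσ⟩
  · simp only [add_smul, ← hσ, map_add]
  · simp only [AddMonoidHom.mk'_apply, ← hσ, one_smul]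

/-- Multiples of `u` and `v` by the same scalar have the same product with `w`, hence so do their
images. -/
theorem map_smul_of_apply_eq (hg : PreservesNull B g.toEquiv) (hB : IsWittIndexOne B)
    {u v w : V} (hv : IsNull B v) (hw : IsNull B w) (hvw : B v w ≠ 0)
    (h : B u w = B v w) {b s : K} (hs : g (b • u) = s • g u) : g (b • v) = s • g v := by
  obtain ⟨σ, -, hσ⟩ := hg.exists_addMonoidHom_map_smul hB (by rintro rfl; simp at hvw) hv
  have hbw : B (g (b • u)) (g w) = B (g (b • v)) (g w) :=
    hg.apply_map_congr hB hw (by rw [LinearMap.map_smul₂, LinearMap.map_smul₂, h])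
  rw [hs, hσ, LinearMap.map_smul₂, LinearMap.map_smul₂, hg.apply_map_congr hB hw h] at hbw
  rw [hσ, mul_right_cancel₀ (mt (hg.apply_map_eq_zero_iff hB hw).1 hvw) hbw]

/-- The scale factor of `u` is shared by the whole conic, which contains a null vector having the
same product with `w` as `t ^ 2 • u`; this makes the scale factor multiplicative. -/
theorem exists_ringHom_map_smul_isNull (hg : PreservesNull B g.toEquiv) (hB : IsWittIndexOne B)
    (hV : 2 < Module.rank K V) : ∃ (σ : K →+* K) (u w : V),
      IsNull B w ∧ B u w ≠ 0 ∧ ∀ b : K, g (b • u) = σ b • g u := by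
  obtain ⟨u, w, hu, hw, huw, hconic⟩ := hB.exists_null_conic hV
  choose n hn hnu hnw using hconic
  have hu0 : u ≠ 0 := by rintro rfl; simp at huw
  have hwu : B w u ≠ 0 := by rwa [hB.isSymm.eq]
  obtain ⟨σ, hσ1, hσ⟩ := hg.exists_addMonoidHom_map_smul hB hu0 hu
  have map_smul_w : ∀ b : K, g (b • w) = σ b • g w := fun b => by
    have hn1 : B u w = B (n 1) w := by rw [hnw, one_pow, one_mul]
    exact hg.map_smul_of_apply_eq hB hw hu hwu (hnu 1)
      (hg.map_smul_of_apply_eq hB (hn 1) hw (hn1 ▸ huw) hn1 (hσ b))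
  have map_smul_n : ∀ b t : K, g (b • n t) = σ b • g (n t) := fun b t =>
    hg.map_smul_of_apply_eq hB (hn t) hu (by rwa [hnu]) (hnu t).symm (map_smul_w b)
  have map_mul_sq : ∀ b t, σ (b * t ^ 2) = σ b * σ (t ^ 2) := fun b t => by
    obtain rfl | ht := eq_or_ne t 0
    · simp
    · have htu : B (t ^ 2 • u) w = t ^ 2 * B u w := LinearMap.map_smul₂ ..
      have := hg.map_smul_of_apply_eq hB (hu.smul _) hw
        (htu ▸ mul_ne_zero (pow_ne_zero 2 ht) huw) ((hnw t).trans htu.symm) (map_smul_n b t)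
      rw [smul_smul, hσ, hσ, smul_smul] at this
      exact smul_left_injective K (g.map_ne_zero_iff.2 hu0) this
  exact ⟨⟨⟨⟨σ, hσ1⟩, map_mul_of_map_mul_sq map_mul_sq⟩, map_zero σ, map_add σ⟩, u, w, hw, huw,
    hσ⟩

theorem exists_ringHom_map_smul (hg : PreservesNull B g.toEquiv) (hB : IsWittIndexOne B)
    (hV : 2 < Module.rank K V) : ∃ σ : K →+* K, ∀ (b : K) (x : V), g (b • x) = σ b • g x := by
  obtain ⟨σ, u, w, hw, huw, hσ⟩ := hg.exists_ringHom_map_smul_isNull hB hV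
  have hw0 : w ≠ 0 := by rintro rfl; simp at huw
  have comp_smul : ∀ b : K, g.toAddMonoidHom.comp (DistribSMul.toAddMonoidHom V b) =
      (DistribSMul.toAddMonoidHom V (σ b)).comp g.toAddMonoidHom := fun b => by
    refine hB.addMonoidHom_ext hV hw0 hw fun v hv hvw => ?_
    refine hg.map_smul_of_apply_eq hB hv hw hvw (u := (B v w / B u w) • u) ?_ ?_
    · rw [LinearMap.map_smul₂, smul_eq_mul, div_mul_cancel₀ _ huw]
    · rw [smul_smul, hσ, hσ, map_mul, smul_smul]
  exact ⟨σ, fun b => DFunLike.congr_fun (comp_smul b)⟩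

theorem exists_apply_map_eq_mul_of_isNull (hg : PreservesNull B g.toEquiv)
    (hB : IsWittIndexOne B) {σ : K →+* K} (hσ : ∀ (b : K) (x : V), g (b • x) = σ b • g x) {w : V}
    (hw0 : w ≠ 0) (hw : IsNull B w) : ∃ a, ∀ x, B (g x) (g w) = a * σ (B x w) := by
  obtain ⟨u, -, huw⟩ := hB.exists_isNull_apply_ne_zero hw0 hw
  refine ⟨B (g u) (g w) / σ (B u w), fun x => ?_⟩
  rw [hg.apply_map_congr hB hw (y := (B x w / B u w) • u) ?_, hσ, LinearMap.map_smul₂, map_div₀,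
    smul_eq_mul, div_mul_comm]
  · rw [LinearMap.map_smul₂, smul_eq_mul, div_mul_cancel₀ _ huw]

theorem exists_apply_map_eq_mul (hg : PreservesNull B g.toEquiv) (hB : IsWittIndexOne B)
    (hV : 2 < Module.rank K V) {σ : K →+* K} (hσ : ∀ (b : K) (x : V), g (b • x) = σ b • g x) :
    ∃ a, ∀ x y, B (g x) (g y) = a * σ (B x y) := by
  obtain ⟨w, hw0, hw⟩ := hB.exists_isNull
  obtain ⟨a, ha⟩ := hg.exists_apply_map_eq_mul_of_isNull hB hσ hw0 hw
  have comp_apply : ∀ x, (B (g x)).toAddMonoidHom.comp g.toAddMonoidHom =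
      (AddMonoidHom.mulLeft a).comp (σ.toAddMonoidHom.comp (B x).toAddMonoidHom) := fun x => by
    refine hB.addMonoidHom_ext hV hw0 hw fun v hv hvw => ?_
    obtain ⟨a', ha'⟩ := hg.exists_apply_map_eq_mul_of_isNull hB hσ (by rintro rfl; simp at hvw) hv
    have haa' : a' = a := by
      have := ha v
      rw [hB.isSymm.eq, ha', hB.isSymm.eq] at this
      exact mul_right_cancel₀ ((map_ne_zero σ).2 hvw) this
    exact haa' ▸ ha' x
  exact ⟨a, fun x => DFunLike.congr_fun (comp_apply x)⟩

/-- The **Alexandrov–Zeeman theorem**. -/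
theorem exists_similarity (hf : PreservesNull B f) (hB : IsWittIndexOne B)
    (hV : 2 < Module.rank K V) : ∃ (g : V ≃+ V) (σ : K →+* K) (a : K),
      (∀ x y, f x - f y = g (x - y)) ∧ (∀ (b : K) (x : V), g (b • x) = σ b • g x) ∧
      ∀ x y, B (g x) (g y) = a * σ (B x y) := by
  obtain ⟨g, hfg⟩ := hf.exists_addEquiv hB hV
  have hg : PreservesNull B g.toEquiv := fun x y => by simp [← map_sub, ← hfg, hf x y]
  obtain ⟨σ, hσ⟩ := hg.exists_ringHom_map_smul hB hV
  obtain ⟨a, ha⟩ := hg.exists_apply_map_eq_mul hB hV hσ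
  exact ⟨g, σ, a, hfg, hσ, ha⟩

/-- Some nonzero vector and its image are both orthogonal to `p`; comparing the lengths of the
images of its multiples shows that the similarity is an isometry. -/
theorem exists_isometry (hf : PreservesNull B f) (hB : IsWittIndexOne B)
    (hV : 2 < Module.rank K V) {p : V} (hp : ∀ z ≠ 0, B z p = 0 → ¬ IsNull B z)
    (hfp : ∀ x y, B (x - y) p = 0 → B (f x - f y) p = 0 →
      B (f x - f y) (f x - f y) = B (x - y) (x - y)) :
    ∃ g : V ≃ₗ[K] V, (∀ x y, f x - f y = g (x - y)) ∧ ∀ x y, B (g x) (g y) = B x y := by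
  obtain ⟨g, σ, a, hfg, hσ, ha⟩ := hf.exists_similarity hB hV
  obtain ⟨z, hz0, hzp, hzq⟩ := exists_ne_zero_orthogonal (B := B) hV p (g.symm p)
  have hzz : B z z ≠ 0 := hp z hz0 hzp
  have hgzp : B (g z) p = 0 := by
    rw [← g.apply_symm_apply p, ha, hzq, map_zero, mul_zero]
  obtain ⟨rfl, rfl⟩ := eq_one_and_eq_id_of_mul_map_sq_mul hzz fun t => by
    have := hfp (t • z) 0 (by rw [sub_zero, LinearMap.map_smul₂, hzp, smul_zero])
      (by rw [hfg, sub_zero, hσ, LinearMap.map_smul₂, hgzp, smul_zero])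
    rw [hfg, sub_zero, ha] at this
    simpa only [map_smul, LinearMap.smul_apply, smul_eq_mul, map_mul, ← mul_assoc, ← pow_two]
      using this
  exact ⟨{ g with map_smul' := hσ }, hfg, fun x y => by simpa using ha x y⟩

end PreservesNull

end PreservesNull

section Minkowski

/-- The Minkowski form of signature `(-, +, …, +)` on coordinate points, the time coordinate being
the one with index `0`. -/
def minkowski (Q : Type*) [Field Q] (d : ℕ) [NeZero d] : LinearMap.BilinForm Q (Fin d → Q) :=
  Matrix.toBilin' (Matrix.diagonal fun i => if i = 0 then -1 else 1)

variable {Q : Type*} [Field Q] {d : ℕ} [NeZero d]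

theorem minkowski_apply (x y : Fin d → Q) :
    minkowski Q d x y = ∑ i, (if i = 0 then -1 else 1) * (x i * y i) := by
  simp only [minkowski, Matrix.toBilin'_apply', dotProduct, Matrix.mulVec_diagonal, mul_left_comm]

theorem minkowski_isSymm : (minkowski Q d).IsSymm :=
  Matrix.isSymm_toBilin'_iff_isSymm.2 (Matrix.isSymm_diagonal _)

theorem minkowski_nondegenerate : (minkowski Q d).Nondegenerate := by
  refine LinearMap.BilinForm.nondegenerate_toBilin'_of_det_ne_zero' _ ?_
  rw [Matrix.det_diagonal, Finset.prod_ne_zero_iff]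
  intro i _
  split_ifs <;> simp

theorem minkowski_single (i : Fin d) (a : Q) (x : Fin d → Q) :
    minkowski Q d (Pi.single i a) x = (if i = 0 then -1 else 1) * (a * x i) := by
  rw [minkowski_apply, Finset.sum_eq_single i (fun j _ hj => by simp [hj]) (by simp),
    Pi.single_eq_same]

theorem minkowski_apply_single_zero (x : Fin d → Q) :
    minkowski Q d x (Pi.single 0 1) = -x 0 := by
  rw [minkowski_isSymm.eq, minkowski_single, if_pos rfl, one_mul, neg_one_mul]

theorem isNull_single_add_single {i : Fin d} (hi : i ≠ 0) :
    IsNull (minkowski Q d) (Pi.single 0 1 + Pi.single i 1) := by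
  simp [IsNull, minkowski_single, hi, hi.symm]

theorem spaceSq_eq (x y : Fin d → Q) :
    spaceSq x y = minkowski Q d (x - y) (x - y) + timeDiff x y ^ 2 := by
  rw [spaceSq, timeDiff, minkowski_apply, Finset.filter_ne', ← Finset.add_sum_erase _ _
    (Finset.mem_univ (0 : Fin d)), if_pos rfl, Pi.sub_apply, add_right_comm, neg_one_mul,
    ← pow_two, neg_add_cancel, zero_add]
  refine Finset.sum_congr rfl fun i hi => ?_
  rw [if_neg (Finset.ne_of_mem_erase hi), one_mul, ← pow_two, Pi.sub_apply]

theorem timeDiff_add_smul (o T : Fin d → Q) (s t : Q) :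
    timeDiff (o + s • T) (o + t • T) = (s - t) * T 0 := by
  simp [timeDiff, sub_mul]

theorem spaceSq_add_smul {T : Fin d → Q} (hT : minkowski Q d T T = -1) (o : Fin d → Q) (s t : Q) :
    spaceSq (o + s • T) (o + t • T) = (s - t) ^ 2 * (T 0 ^ 2 - 1) := by
  rw [spaceSq_eq, timeDiff_add_smul, add_sub_add_left_eq_sub, ← sub_smul, map_smul,
    LinearMap.map_smul₂, hT, smul_eq_mul, smul_eq_mul]
  ring

variable [LinearOrder Q] [IsStrictOrderedRing Q]

theorem minkowski_self_pos {z : Fin d → Q} (hz : z ≠ 0) (hz0 : z 0 = 0) :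
    0 < minkowski Q d z z := by
  obtain ⟨i, hi⟩ := Function.ne_iff.1 hz
  have hi0 : i ≠ 0 := fun h => hi (by rw [h, hz0, Pi.zero_apply])
  have hspace := spaceSq_eq z 0
  rw [timeDiff, hz0, Pi.zero_apply, sub_zero, sub_zero, zero_pow two_ne_zero, add_zero] at hspace
  rw [← hspace]
  refine Finset.sum_pos' (fun j _ => sq_nonneg _) ⟨i, by simp [hi0], ?_⟩
  exact sq_pos_of_ne_zero (sub_ne_zero.2 hi)

theorem apply_zero_ne_zero_of_minkowski_self_eq {T : Fin d → Q}
    (hT : minkowski Q d T T = -1) : T 0 ≠ 0 := fun h => by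
  have := minkowski_self_pos (by rintro rfl; simp at hT) h
  rw [hT] at this
  exact neg_one_lt_zero.not_gt this

theorem minkowski_isWittIndexOne (hd : 2 ≤ d) : IsWittIndexOne (minkowski Q d) where
  isSymm := minkowski_isSymm
  nondegenerate := minkowski_nondegenerate
  exists_isNull := by
    have h1 : (⟨1, hd⟩ : Fin d) ≠ 0 := fun h => one_ne_zero (Fin.ext_iff.1 h)
    exact ⟨_, fun h => by simpa [h1.symm] using congrFun h 0, isNull_single_add_single h1⟩
  exists_eq_smul u v hu0 hu hv huv := by
    have hu00 : u 0 ≠ 0 := fun h => (minkowski_self_pos hu0 h).ne' hu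
    refine ⟨v 0 / u 0, sub_eq_zero.1 ?_⟩
    by_contra hne
    refine (minkowski_self_pos hne (by simp [hu00])).ne' ?_
    rw [← IsNull, isNull_sub_iff minkowski_isSymm hv (hu.smul _), map_smul, minkowski_isSymm.eq,
      huv, smul_zero]

end Minkowski

namespace WorldviewModel

variable {B Q : Type*} [Field Q] [LinearOrder Q] [IsStrictOrderedRing Q] {d : ℕ} [NeZero d]
  {M : WorldviewModel B Q d} {m k : B}

theorem speedSq_iff_of_wl_eq_range {o T : Fin d → Q} (hT : minkowski Q d T T = -1)
    (hwl : M.wl m k = Set.range fun t : Q => o + t • T) {v : Q} :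
    M.SpeedSq m k v ↔ (1 - v) * T 0 ^ 2 = 1 := by
  have mem_wl : ∀ t : Q, M.W m k (o + t • T) := fun t => hwl.ge ⟨t, rfl⟩
  constructor
  · rintro ⟨x, y, hxy, hx, hy, hv⟩
    obtain ⟨s, rfl⟩ := hwl.le hx
    obtain ⟨t, rfl⟩ := hwl.le hy
    have hst : s - t ≠ 0 := fun h => hxy (by rw [sub_eq_zero.1 h])
    rw [spaceSq_add_smul hT, timeDiff_add_smul] at hv
    exact mul_left_cancel₀ (pow_ne_zero 2 hst) (by linear_combination hv)
  · intro hv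
    refine ⟨o + (1 : Q) • T, o + (0 : Q) • T, fun h => ?_, mem_wl 1, mem_wl 0, ?_⟩
    · exact apply_zero_ne_zero_of_minkowski_self_eq hT (by simpa using congrFun h 0)
    · rw [spaceSq_add_smul hT, timeDiff_add_smul]
      linear_combination hv

namespace SpecRel

/-- The light signal through the origin and `⟨1, 1, 0, …, 0⟩` fixes the speed of light to `1`. -/
theorem exists_photon_iff (hM : M.SpecRel) (hd : 2 ≤ d) (hm : M.IOb m) (x y : Fin d → Q) :
    (∃ p, M.Ph p ∧ M.W m p x ∧ M.W m p y) ↔ IsNull (minkowski Q d) (x - y) := by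
  obtain ⟨c, -, hc⟩ := hM.axPh m hm
  obtain ⟨p, hp, h0, h1⟩ := hM.axSymD.2 m hm
  have hunit := (hc _ _).1 ⟨p, hp, h1, h0⟩
  let i : Fin d := ⟨1, hd⟩
  have hi : i ≠ 0 := fun h => one_ne_zero (Fin.ext_iff.1 h)
  have hsum : (fun j : Fin d => if j.val ≤ 1 then (1 : Q) else 0) =
      Pi.single 0 1 + Pi.single i 1 := by
    funext j
    have hj0 : j = 0 ↔ j.val = 0 := Fin.ext_iff
    have hji : j = i ↔ j.val = 1 := Fin.ext_iff
    simp only [Pi.add_apply, Pi.single_apply, hj0, hji]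
    split_ifs <;> first | omega | simp
  have hnull : minkowski Q d _ _ = 0 := isNull_single_add_single hi
  have hc1 : c ^ 2 = 1 := by
    rw [spaceSq_eq, hsum, ← Pi.zero_def, sub_zero, hnull] at hunit
    simpa [timeDiff, hi.symm, eq_comm] using hunit
  rw [hc, hc1, one_mul, spaceSq_eq, add_eq_right, IsNull]

theorem ev_injective (hM : M.SpecRel) (hd : 2 ≤ d) (hm : M.IOb m) :
    Function.Injective (M.ev m) := fun x y h => by
  refine (minkowski_isWittIndexOne hd).eq_of_forall_isNull_sub fun z => ?_
  rw [← hM.exists_photon_iff hd hm, ← hM.exists_photon_iff hd hm]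
  exact exists_congr fun p => and_congr_right fun _ => and_congr_left fun _ => Set.ext_iff.1 h p

theorem exists_equiv_ev_eq (hM : M.SpecRel) (hd : 2 ≤ d) (hk : M.IOb k) (hm : M.IOb m) :
    ∃ f : (Fin d → Q) ≃ (Fin d → Q), ∀ x, M.ev k x = M.ev m (f x) := by
  have exists_ev_eq : ∀ {m k}, M.IOb m → M.IOb k → ∀ x, ∃ y, M.ev m x = M.ev k y :=
    fun hm hk x => (hM.axEv _ _ hm hk x).imp fun _ => Set.ext
  choose f hf using exists_ev_eq hk hm
  choose f' hf' using exists_ev_eq hm hk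
  exact ⟨⟨f, f', fun x => hM.ev_injective hd hk (by rw [hf x, hf']),
    fun y => hM.ev_injective hd hm (by rw [hf' y, hf])⟩, hf⟩

theorem exists_poincare (hM : M.SpecRel) (hd : 3 ≤ d) (hk : M.IOb k) (hm : M.IOb m) :
    ∃ (f : (Fin d → Q) ≃ (Fin d → Q)) (g : (Fin d → Q) ≃ₗ[Q] (Fin d → Q)),
      (∀ x, M.ev k x = M.ev m (f x)) ∧ (∀ x y, f x - f y = g (x - y)) ∧
      ∀ x y, minkowski Q d (g x) (g y) = minkowski Q d x y := by
  have hd2 : 2 ≤ d := by omega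
  obtain ⟨f, hf⟩ := hM.exists_equiv_ev_eq hd2 hk hm
  have hnull : PreservesNull (minkowski Q d) f := fun x y => by
    have hev : ∀ x b, M.W k b x ↔ M.W m b (f x) := fun x => Set.ext_iff.1 (hf x)
    rw [← hM.exists_photon_iff hd2 hm, ← hM.exists_photon_iff hd2 hk]
    simp only [hev]
  obtain ⟨g, hfg, hg⟩ := hnull.exists_isometry (minkowski_isWittIndexOne hd2)
    (by rw [rank_fin_fun]; exact_mod_cast hd) (p := Pi.single 0 1)
    (fun z hz0 hz => by
      rw [minkowski_apply_single_zero, neg_eq_zero] at hz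
      exact (minkowski_self_pos hz0 hz).ne')
    (fun x y hxy hfxy => by
      rw [minkowski_apply_single_zero, neg_eq_zero] at hxy hfxy
      have := hM.axSymD.1 k m hk hm x y (f x) (f y) (sub_eq_zero.1 hxy) (sub_eq_zero.1 hfxy)
        (hf x) (hf y)
      rw [spaceSq_eq, spaceSq_eq, timeDiff, timeDiff, ← Pi.sub_apply, ← Pi.sub_apply, hxy, hfxy,
        add_left_inj] at this
      exact this.symm)
  exact ⟨f, g, hf, hfg, hg⟩

/-- In the coordinates of `m`, the worldline of `k` is a line whose direction is the four-velocity
`T`, and it is parametrized by the proper time of `k`. -/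
theorem exists_fourVelocity (hM : M.SpecRel) (hd : 3 ≤ d) (hk : M.IOb k) (hm : M.IOb m) :
    ∃ o T : Fin d → Q, minkowski Q d T T = -1 ∧
      ∀ t : Q, M.ev k (Pi.single 0 t) = M.ev m (o + t • T) := by
  obtain ⟨f, g, hf, hfg, hg⟩ := hM.exists_poincare hd hk hm
  refine ⟨f 0, g (Pi.single 0 1), ?_, fun t => ?_⟩
  · rw [hg, minkowski_apply_single_zero, Pi.single_eq_same]
  · have hsmul : t • (Pi.single 0 1 : Fin d → Q) = Pi.single 0 t - 0 := by
      rw [← Pi.single_smul, smul_eq_mul, mul_one, sub_zero]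
    rw [hf, ← map_smul, hsmul, ← hfg, add_sub_cancel]

theorem mem_wl_self_iff (hM : M.SpecRel) (hk : M.IOb k) {x : Fin d → Q} :
    x ∈ M.wl k k ↔ ∃ t, x = Pi.single 0 t := by
  refine (hM.axSelf k hk x).trans ⟨fun h => ⟨x 0, funext fun i => ?_⟩, ?_⟩
  · obtain rfl | hi := eq_or_ne i 0
    · rw [Pi.single_eq_same]
    · rw [h i hi, Pi.single_eq_of_ne hi]
  · rintro ⟨t, rfl⟩ i hi
    exact Pi.single_eq_of_ne hi _

theorem wl_eq_range (hM : M.SpecRel) (hd : 2 ≤ d) (hk : M.IOb k) (hm : M.IOb m)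
    {o T : Fin d → Q} (hev : ∀ t : Q, M.ev k (Pi.single 0 t) = M.ev m (o + t • T)) :
    M.wl m k = Set.range fun t : Q => o + t • T := by
  ext x
  constructor
  · intro hx
    obtain ⟨y, hy⟩ := hM.axEv m k hm hk x
    obtain ⟨t, rfl⟩ := (hM.mem_wl_self_iff hk).1 ((hy k).1 hx)
    exact ⟨t, hM.ev_injective hd hm ((hev t).symm.trans (Set.ext hy).symm)⟩
  · rintro ⟨t, rfl⟩
    exact (Set.ext_iff.1 (hev t) k).1 ((hM.mem_wl_self_iff hk).2 ⟨t, rfl⟩)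

/-- The witness `γ` is the time component of the four-velocity of `k`. -/
theorem exists_lorentzFactor (hM : M.SpecRel) (hd : 3 ≤ d) (hm : M.IOb m) (hk : M.IOb k) :
    ∃ γ : Q, γ ≠ 0 ∧ (∀ v, M.SpeedSq m k v ↔ (1 - v) * γ ^ 2 = 1) ∧
      ∀ x y x' y', x ∈ M.wl k k → y ∈ M.wl k k → M.worldview k m x x' → M.worldview k m y y' →
        timeDiff x' y' = timeDiff x y * γ := by
  have hd2 : 2 ≤ d := by omega
  obtain ⟨o, T, hT, hev⟩ := hM.exists_fourVelocity hd hk hm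
  have ev_inj := hM.ev_injective hd2 hm
  refine ⟨T 0, apply_zero_ne_zero_of_minkowski_self_eq hT,
    fun v => speedSq_iff_of_wl_eq_range hT (hM.wl_eq_range hd2 hk hm hev), ?_⟩
  rintro x y x' y' hx hy ⟨hxx', -⟩ ⟨hyy', -⟩
  obtain ⟨s, rfl⟩ := (hM.mem_wl_self_iff hk).1 hx
  obtain ⟨t, rfl⟩ := (hM.mem_wl_self_iff hk).1 hy
  obtain rfl := ev_inj (hxx'.symm.trans (hev s))
  obtain rfl := ev_inj (hyy'.symm.trans (hev t))
  rw [timeDiff_add_smul, timeDiff, Pi.single_eq_same, Pi.single_eq_same]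

end SpecRel

end WorldviewModel

/-- Time dilation. The squared speed of `k` according to `m` is well defined, it differs from `1`
(so that the quotient below is a genuine one), and the time dilation formula holds. -/
theorem corollary3p4 {B Q : Type*} [Field Q] [LinearOrder Q] [IsStrictOrderedRing Q]
    {d : ℕ} [NeZero d] (hd : 3 ≤ d) (M : WorldviewModel B Q d) (hM : M.SpecRel)
    (m k : B) (hm : M.IOb m) (hk : M.IOb k) :
    (∃! v : Q, M.SpeedSq m k v) ∧
    ∀ v : Q, M.SpeedSq m k v → v ≠ 1 ∧
      ∀ x y x' y' : Fin d → Q, x ∈ M.wl k k → y ∈ M.wl k k →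
        M.worldview k m x x' → M.worldview k m y y' →
          timeDiff x' y' ^ 2 = timeDiff x y ^ 2 / (1 - v) := by
  obtain ⟨γ, hγ, hspeed, htime⟩ := hM.exists_lorentzFactor hd hm hk
  have hγ2 : γ ^ 2 ≠ 0 := pow_ne_zero 2 hγ
  refine ⟨⟨1 - (γ ^ 2)⁻¹, (hspeed _).2 ?_, fun v hv => ?_⟩, fun v hv => ?_⟩
  · rw [sub_sub_cancel, inv_mul_cancel₀ hγ2]
  · rw [← eq_inv_of_mul_eq_one_left ((hspeed v).1 hv), sub_sub_cancel]
  · have hv1 : 1 - v ≠ 0 := left_ne_zero_of_mul_eq_one ((hspeed v).1 hv)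
    refine ⟨(sub_ne_zero.1 hv1).symm, fun x y x' y' hx hy hxx' hyy' => ?_⟩
    rw [htime x y x' y' hx hy hxx' hyy', eq_div_iff hv1, mul_pow, mul_assoc, mul_comm (γ ^ 2),
      (hspeed v).1 hv, mul_one]
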